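/- Call a family $\mathcal B$ of closed subsets of a topological space $X$ a closed subbase if every closed subset of $X$ is an intersection of finite unions of members of $\mathcal B$ (the empty union being allowed). A closed subbase $\mathcal B$ is binary if $\bigcap\mathcal A\neq\emptyset$ for every $\mathcal A\subseteq\mathcal B$ that is linked, i.e. satisfies $A_0\cap A_1\neq\emptyset$ for all $A_0,A_1\in\mathcal A$ (here $\bigcap\emptyset=X$). A family $\mathcal F$ of subsets of a group $G$ is translation invariant if $gF\in\mathcal F$ whenever $g\in G$ and $F\in\mathcal F$. A space is $0$-dimensional if its clopen subsets form a base. Then every compact Hausdorff Abelian topological group, and every $0$-dimensional compact Hausdorff topological group, has a translation invariant closed binary subbase. -/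

import Mathlib

open scoped Pointwise

/-- A family `ℬ` of subsets of a topological space `X` is a subbase for the closed sets of `X`
(a *closed subbase*): its members are closed, and every closed set is the intersection of a family
of finite unions of members of `ℬ`. The empty union is allowed. -/
def IsClosedSubbase {X : Type*} [TopologicalSpace X] (ℬ : Set (Set X)) : Prop :=
  (∀ B ∈ ℬ, IsClosed B) ∧
    ∀ C : Set X, IsClosed C →
      ∃ 𝒞 : Set (Set X), (∀ D ∈ 𝒞, ∃ ℱ ⊆ ℬ, ℱ.Finite ∧ D = ⋃₀ ℱ) ∧ C = ⋂₀ 𝒞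

/-- A family of sets is *linked* if any two of its members (equal or not) intersect. -/
def IsLinkedFamily {X : Type*} (𝒜 : Set (Set X)) : Prop :=
  ∀ A ∈ 𝒜, ∀ B ∈ 𝒜, (A ∩ B).Nonempty

/-- A family of sets is *binary* if each of its linked subfamilies has nonempty intersection. -/
def IsBinaryFamily {X : Type*} (ℬ : Set (Set X)) : Prop :=
  ∀ 𝒜 ⊆ ℬ, IsLinkedFamily 𝒜 → (⋂₀ 𝒜).Nonempty

/-- A family of subsets of a group is *translation invariant* if it contains `gF` whenever it
contains `F`. -/
def IsTranslationInvariant {G : Type*} [Group G] (ℱ : Set (Set G)) : Prop :=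
  ∀ g : G, ∀ F ∈ ℱ, g • F ∈ ℱ

/-- A topological space is *`0`-dimensional* if its clopen subsets form a base. -/
def IsZeroDimensional (X : Type*) [TopologicalSpace X] : Prop :=
  TopologicalSpace.IsTopologicalBasis {U : Set X | IsClopen U}

open Set Filter Topology

/-!
Call `ℬ` a binary subbase modulo a subgroup `N` if it is the preimage of a translation invariant
closed binary subbase of `G ⧸ N`. Such an `ℬ` determines `N`, and unions of chains are again of this
kind by compactness, so by Zorn's lemma it suffices, given `1 ≠ a ∈ N`, to enlarge `ℬ` so that it
also separates `a` from `1`.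

Let `q` be a continuous homomorphism with `q a ≠ 1`. If `q N` is discrete, cut the members of `ℬ`
into small closed pieces `S` with `S * N ∈ ℬ`: two intersecting pieces cannot differ by a nontrivial
element of `q N`, so linked families of pieces still have a common point. If `q N` is the whole
circle, add the preimages of the short arcs: as `N` acts transitively on the circle through `q`, a
point common to the members of `ℬ` can be moved along `N` to one common to the arcs as well.

For `0`-dimensional `G` the homomorphisms `q` are the finite quotients. For Abelian `G` they are the
characters, which separate points: the average `T` of the rank-one operators along an orbit of a
unitary representation generates together with the representation a commutative C⋆-algebra, and a
character `φ` of this algebra with `φ T ≠ 0` restricts to a character of `G`, which is continuous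
because `g ↦ U g * T` is norm continuous.
-/

section BinaryFamily

variable {X : Type*} {ℬ : Set (Set X)}

theorem IsBinaryFamily.exists_forall_subset_imp_mem (h : IsBinaryFamily ℬ) {𝒜 : Set (Set X)}
    (h𝒜 : IsLinkedFamily 𝒜) : ∃ x, ∀ A ∈ 𝒜, ∀ B ∈ ℬ, A ⊆ B → x ∈ B := by
  have hlinked : IsLinkedFamily {B ∈ ℬ | ∃ A ∈ 𝒜, A ⊆ B} := by
    rintro B ⟨-, A, hA, hAB⟩ B' ⟨-, A', hA', hAB'⟩
    exact (h𝒜 A hA A' hA').mono (inter_subset_inter hAB hAB')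
  obtain ⟨x, hx⟩ := h _ (sep_subset _ _) hlinked
  exact ⟨x, fun A hA B hB hAB => hx B ⟨hB, A, hA, hAB⟩⟩

theorem IsBinaryFamily.finiteInterClosure (h : IsBinaryFamily ℬ) :
    IsBinaryFamily (FiniteInter.finiteInterClosure ℬ) := by
  intro 𝒜 h𝒜 hlinked
  obtain ⟨x, hx⟩ := h.exists_forall_subset_imp_mem hlinked
  have hmem : ∀ C ∈ FiniteInter.finiteInterClosure ℬ, ∀ A ∈ 𝒜, A ⊆ C → x ∈ C := by
    intro C hC A hA hAC
    induction hC with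
    | basic hB => exact hx A hA _ hB hAC
    | univ => trivial
    | inter _ _ ih ih' =>
      exact ⟨ih (hAC.trans inter_subset_left), ih' (hAC.trans inter_subset_right)⟩
  exact ⟨x, fun A hA => hmem A (h𝒜 hA) A hA Subset.rfl⟩

theorem IsBinaryFamily.sUnion_of_isChain [TopologicalSpace X] [CompactSpace X]
    {𝒞 : Set (Set (Set X))} (hchain : IsChain (· ⊆ ·) 𝒞) (hne : 𝒞.Nonempty)
    (hclosed : ∀ ℬ ∈ 𝒞, ∀ B ∈ ℬ, IsClosed B) (hbinary : ∀ ℬ ∈ 𝒞, IsBinaryFamily ℬ) :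
    IsBinaryFamily (⋃₀ 𝒞) := by
  intro 𝒜 h𝒜 hlinked
  have hfinite : ∀ ℱ ⊆ 𝒜, ℱ.Finite → (⋂₀ ℱ).Nonempty := by
    intro ℱ hℱ hfin
    obtain ⟨ℬ, hℬ, hℱℬ⟩ := DirectedOn.exists_mem_subset_of_finite_of_subset_sUnion hne
      hchain.directedOn hfin (hℱ.trans h𝒜)
    exact hbinary ℬ hℬ ℱ hℱℬ fun A hA B hB => hlinked A (hℱ hA) B (hℱ hB)
  rw [sInter_eq_iInter]
  refine CompactSpace.iInter_nonempty (fun A => ?_) fun u => ?_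
  · obtain ⟨ℬ, hℬ, hA⟩ := h𝒜 A.2
    exact hclosed ℬ hℬ A hA
  · refine (hfinite _ ?_ (u.finite_toSet.image (↑))).mono ?_
    · rintro _ ⟨A, -, rfl⟩
      exact A.2
    · simp only [sInter_image, Finset.mem_coe, subset_refl]

theorem IsTranslationInvariant.finiteInterClosure {G : Type*} [Group G] {ℬ : Set (Set G)}
    (h : IsTranslationInvariant ℬ) :
    IsTranslationInvariant (FiniteInter.finiteInterClosure ℬ) := by
  intro g B hB
  induction hB with
  | basic hB => exact .basic (h g _ hB)
  | univ => rw [smul_set_univ]; exact .univ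
  | inter _ _ ih ih' => rw [smul_set_inter]; exact .inter ih ih'

end BinaryFamily

/-- `IsBinarySubbaseMod N ℬ` says that `ℬ` is the preimage in `G` of a translation invariant closed
binary subbase of the space `G ⧸ N` of left cosets. The subbase property is stated as separation
of points by finite unions of members, which is equivalent to it when `G` is compact. -/
structure IsBinarySubbaseMod {G : Type*} [Group G] [TopologicalSpace G] (N : Subgroup G)
    (ℬ : Set (Set G)) : Prop where
  isClosed : ∀ B ∈ ℬ, IsClosed B
  mul_mem : ∀ B ∈ ℬ, ∀ x ∈ B, ∀ n ∈ N, x * n ∈ B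
  binary : IsBinaryFamily ℬ
  invariant : IsTranslationInvariant ℬ
  separating : ∀ x y : G, x⁻¹ * y ∉ N → ∃ ℱ ⊆ ℬ, ℱ.Finite ∧ ⋃₀ ℱ ∈ 𝓝 y ∧ x ∉ ⋃₀ ℱ

namespace IsBinarySubbaseMod

variable {G : Type*} [Group G] [TopologicalSpace G] {N : Subgroup G} {ℬ : Set (Set G)}

theorem mul_mem_iff (h : IsBinarySubbaseMod N ℬ) {B : Set G} (hB : B ∈ ℬ) {x n : G} (hn : n ∈ N) :
    x * n ∈ B ↔ x ∈ B :=
  ⟨fun hx => by simpa only [mul_inv_cancel_right] using h.mul_mem B hB _ hx n⁻¹ (N.inv_mem hn),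
    fun hx => h.mul_mem B hB x hx n hn⟩

theorem mem_subgroup_iff (h : IsBinarySubbaseMod N ℬ) {n : G} :
    n ∈ N ↔ ∀ B ∈ ℬ, n ∈ B → 1 ∈ B := by
  refine ⟨fun hn B hB hnB => by rwa [← one_mul n, h.mul_mem_iff hB hn] at hnB, fun hn => ?_⟩
  by_contra hnN
  obtain ⟨ℱ, hℱ, -, hnhds, h1⟩ := h.separating 1 n (by simpa only [inv_one, one_mul] using hnN)
  obtain ⟨B, hB, hnB⟩ := mem_of_mem_nhds hnhds
  exact h1 ⟨B, hB, hn B (hℱ hB) hnB⟩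

theorem subgroup_unique {N' : Subgroup G} (h : IsBinarySubbaseMod N ℬ)
    (h' : IsBinarySubbaseMod N' ℬ) : N = N' :=
  Subgroup.ext fun _ => h.mem_subgroup_iff.trans h'.mem_subgroup_iff.symm

theorem isClosed_subgroup (h : IsBinarySubbaseMod N ℬ) : IsClosed (N : Set G) := by
  refine isClosed_iff_nhds.2 fun n hn => ?_
  by_contra hnN
  obtain ⟨ℱ, hℱ, -, hnhds, h1⟩ := h.separating 1 n (by rwa [inv_one, one_mul])
  obtain ⟨z, ⟨B, hB, hzB⟩, hzN⟩ := hn _ hnhds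
  exact h1 ⟨B, hB, h.mem_subgroup_iff.1 hzN B (hℱ hB) hzB⟩

theorem top : IsBinarySubbaseMod (⊤ : Subgroup G) {univ} where
  isClosed := by rintro _ rfl; exact isClosed_univ
  mul_mem := by rintro _ rfl x - n -; trivial
  binary := fun 𝒜 h𝒜 _ => ⟨1, fun A hA => by rw [h𝒜 hA]; trivial⟩
  invariant := by rintro g _ rfl; exact smul_set_univ
  separating _ _ h := (h trivial).elim

theorem isClosedSubbase [CompactSpace G] (h : IsBinarySubbaseMod ⊥ ℬ) : IsClosedSubbase ℬ := by
  refine ⟨h.isClosed, fun C hC => ⟨{D | (∃ ℱ ⊆ ℬ, ℱ.Finite ∧ D = ⋃₀ ℱ) ∧ C ⊆ D},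
    fun D hD => hD.1, Subset.antisymm (subset_sInter fun D hD => hD.2) fun x hx => ?_⟩⟩
  by_contra hxC
  have hsep : ∀ y ∈ C, ∃ ℱ ⊆ ℬ, ℱ.Finite ∧ ⋃₀ ℱ ∈ 𝓝 y ∧ x ∉ ⋃₀ ℱ := by
    refine fun y hy => h.separating x y fun hxy => hxC ?_
    rwa [inv_mul_eq_one.1 (Subgroup.mem_bot.1 hxy)]
  choose! ℱ hℱ hfin hnhds hxℱ using hsep
  obtain ⟨t, ht, hCt⟩ := hC.isCompact.elim_nhds_subcover (fun y => ⋃₀ ℱ y) hnhds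
  obtain ⟨B, hB, hxB⟩ : x ∈ ⋃₀ ⋃ y ∈ t, ℱ y := hx _ ⟨⟨_, iUnion₂_subset fun y hy => hℱ y (ht y hy),
    t.finite_toSet.biUnion fun y hy => hfin y (ht y hy), rfl⟩, by
      simpa only [sUnion_iUnion] using hCt⟩
  obtain ⟨y, hy, hBy⟩ := mem_iUnion₂.1 hB
  exact hxℱ y (ht y hy) ⟨B, hBy, hxB⟩

theorem finiteInterClosure (h : IsBinarySubbaseMod N ℬ) :
    IsBinarySubbaseMod N (FiniteInter.finiteInterClosure ℬ) where
  isClosed B hB := by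
    induction hB with
    | basic hB => exact h.isClosed _ hB
    | univ => exact isClosed_univ
    | inter _ _ ih ih' => exact ih.inter ih'
  mul_mem B hB x hx n hn := by
    induction hB with
    | basic hB => exact h.mul_mem _ hB x hx n hn
    | univ => trivial
    | inter _ _ ih ih' => exact ⟨ih hx.1, ih' hx.2⟩
  binary := h.binary.finiteInterClosure
  invariant := h.invariant.finiteInterClosure
  separating x y hxy := by
    obtain ⟨ℱ, hℱ, hsep⟩ := h.separating x y hxy
    exact ⟨ℱ, fun B hB => .basic (hℱ hB), hsep⟩

theorem sUnion_of_isChain [CompactSpace G] {𝒞 : Set (Set (Set G))} (hchain : IsChain (· ⊆ ·) 𝒞)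
    (hne : 𝒞.Nonempty) {N : Set (Set G) → Subgroup G}
    (h : ∀ ℬ ∈ 𝒞, IsBinarySubbaseMod (N ℬ) ℬ) : IsBinarySubbaseMod (⨅ ℬ ∈ 𝒞, N ℬ) (⋃₀ 𝒞) where
  isClosed := fun B ⟨ℬ, hℬ, hB⟩ => (h ℬ hℬ).isClosed B hB
  mul_mem := fun B ⟨ℬ, hℬ, hB⟩ x hx n hn =>
    (h ℬ hℬ).mul_mem B hB x hx n (iInf₂_le (f := fun ℬ _ => N ℬ) ℬ hℬ hn)
  binary := .sUnion_of_isChain hchain hne (fun ℬ hℬ => (h ℬ hℬ).isClosed)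
    fun ℬ hℬ => (h ℬ hℬ).binary
  invariant := fun g B ⟨ℬ, hℬ, hB⟩ => ⟨ℬ, hℬ, (h ℬ hℬ).invariant g B hB⟩
  separating x y hxy := by
    simp only [Subgroup.mem_iInf, not_forall] at hxy
    obtain ⟨ℬ, hℬ, hxy⟩ := hxy
    obtain ⟨ℱ, hℱ, hsep⟩ := (h ℬ hℬ).separating x y hxy
    exact ⟨ℱ, hℱ.trans (subset_sUnion_of_mem hℬ), hsep⟩

theorem exists_bot [CompactSpace G]
    (hstep : ∀ (N : Subgroup G) (ℬ : Set (Set G)), IsBinarySubbaseMod N ℬ → ∀ a ∈ N, a ≠ 1 →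
      ∃ N' : Subgroup G, a ∉ N' ∧ ∃ ℬ', ℬ ⊆ ℬ' ∧ IsBinarySubbaseMod N' ℬ') :
    ∃ ℬ : Set (Set G), IsBinarySubbaseMod ⊥ ℬ := by
  have hchain : ∀ 𝒞 ⊆ {ℬ : Set (Set G) | ∃ N, IsBinarySubbaseMod N ℬ}, IsChain (· ⊆ ·) 𝒞 →
      𝒞.Nonempty → ∃ 𝒰 ∈ {ℬ | ∃ N, IsBinarySubbaseMod N ℬ}, ∀ ℬ ∈ 𝒞, ℬ ⊆ 𝒰 := by
    intro 𝒞 h𝒞 hc hne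
    choose! N hN using h𝒞
    exact ⟨⋃₀ 𝒞, ⟨_, sUnion_of_isChain hc hne hN⟩, fun ℬ hℬ => subset_sUnion_of_mem hℬ⟩
  obtain ⟨ℬ, -, ⟨N, hN⟩, hmax⟩ := zorn_subset_nonempty _ hchain {univ} ⟨⊤, top⟩
  suffices N = ⊥ from ⟨ℬ, this ▸ hN⟩
  refine (Subgroup.eq_bot_iff_forall N).2 fun a ha => ?_
  by_contra ha1
  obtain ⟨N', haN', ℬ', hsub, h'⟩ := hstep N ℬ hN a ha ha1
  obtain rfl : ℬ = ℬ' := hsub.antisymm (hmax ⟨N', h'⟩ hsub)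
  exact haN' (hN.subgroup_unique h' ▸ ha)

theorem exists_sUnion_mem_nhds_subset [CompactSpace G] (h : IsBinarySubbaseMod N ℬ)
    (hinter : FiniteInter ℬ) {V : Set G} (hV : IsOpen V) {y : G} (hy : ∀ n ∈ N, y * n ∈ V) :
    ∃ ℱ ⊆ ℬ, ℱ.Finite ∧ ⋃₀ ℱ ∈ 𝓝 y ∧ ⋃₀ ℱ ⊆ V := by
  suffices ∃ ℱ ⊆ ℬ, ℱ.Finite ∧ ⋃₀ ℱ ∈ 𝓝 y ∧ Vᶜ ⊆ (⋃₀ ℱ)ᶜ by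
    simpa only [compl_subset_compl] using this
  refine hV.isClosed_compl.isCompact.induction_on
    (p := fun K => ∃ ℱ ⊆ ℬ, ℱ.Finite ∧ ⋃₀ ℱ ∈ 𝓝 y ∧ K ⊆ (⋃₀ ℱ)ᶜ) ?_ ?_ ?_ ?_
  · exact ⟨{univ}, singleton_subset_iff.2 hinter.univ_mem, finite_singleton _,
      by rw [sUnion_singleton]; exact univ_mem, empty_subset _⟩
  · rintro K L hKL ⟨ℱ, hℱ, hfin, hnhds, hL⟩
    exact ⟨ℱ, hℱ, hfin, hnhds, hKL.trans hL⟩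
  · rintro K L ⟨ℱ, hℱ, hfin, hnhds, hK⟩ ⟨ℱ', hℱ', hfin', hnhds', hL⟩
    have heq : ⋃₀ image2 (· ∩ ·) ℱ ℱ' = ⋃₀ ℱ ∩ ⋃₀ ℱ' := by
      rw [← image_uncurry_prod, sUnion_image, sUnion_inter_sUnion]; rfl
    refine ⟨image2 (· ∩ ·) ℱ ℱ', ?_, hfin.image2 _ hfin', heq ▸ inter_mem hnhds hnhds', ?_⟩
    · exact image2_subset_iff.2 fun A hA B hB => hinter.inter_mem (hℱ hA) (hℱ' hB)
    · rw [heq, compl_inter]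
      exact union_subset_union hK hL
  · intro z hz
    have hzy : z⁻¹ * y ∉ N := fun hzy => hz <| by
      simpa only [mul_inv_rev, inv_inv, mul_inv_cancel_left] using hy _ (N.inv_mem hzy)
    obtain ⟨ℱ, hℱ, hfin, hnhds, hzℱ⟩ := h.separating z y hzy
    have hopen : IsOpen (⋃₀ ℱ)ᶜ :=
      (sUnion_eq_biUnion ▸ hfin.isClosed_biUnion fun B hB => h.isClosed B (hℱ hB)).isOpen_compl
    exact ⟨_, mem_nhdsWithin_of_mem_nhds (hopen.mem_nhds hzℱ), ℱ, hℱ, hfin, hnhds, Subset.rfl⟩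

end IsBinarySubbaseMod

/-- The pieces into which the members of a binary subbase `ℬ` modulo `N` are cut to obtain a binary
subbase modulo `N ⊓ q.ker`: a piece `S` sweeps out a member of `ℬ` under right translation by `N`,
and its image under `q` is small, in the sense that quotients of its elements lie in `E`. -/
structure IsSmallPiece {G Q : Type*} [Group G] [TopologicalSpace G] [Group Q] (N : Subgroup G)
    (ℬ : Set (Set G)) (q : G →* Q) (E : Set Q) (S : Set G) : Prop where
  isClosed : IsClosed S
  mul_mem : ∀ x ∈ S, ∀ n ∈ N ⊓ q.ker, x * n ∈ S
  mul_subgroup_mem : S * (N : Set G) ∈ ℬ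
  small : ∀ x ∈ S, ∀ y ∈ S, q (x⁻¹ * y) ∈ E

section Refinement

variable {G Q : Type*} [Group G] [TopologicalSpace G] [Group Q] {N : Subgroup G}
  {ℬ : Set (Set G)} {q : G →* Q} {E : Set Q}

theorem IsSmallPiece.smul [IsTopologicalGroup G] (hℬ : IsTranslationInvariant ℬ) {S : Set G}
    (hS : IsSmallPiece N ℬ q E S) (g : G) : IsSmallPiece N ℬ q E (g • S) where
  isClosed := hS.isClosed.smul g
  mul_mem := by
    rintro _ ⟨x, hx, rfl⟩ n hn
    exact ⟨x * n, hS.mul_mem x hx n hn, (mul_assoc g x n).symm⟩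
  mul_subgroup_mem := by
    rw [smul_mul_assoc]
    exact hℬ g _ hS.mul_subgroup_mem
  small := by
    rintro _ ⟨x, hx, rfl⟩ _ ⟨y, hy, rfl⟩
    simpa only [smul_eq_mul, mul_inv_rev, mul_assoc, inv_mul_cancel_left] using hS.small x hx y hy

theorem IsSmallPiece.mem_of_mem_mul_subgroup {S A : Set G} (hS : IsSmallPiece N ℬ q E S)
    (hA : IsSmallPiece N ℬ q E A) (hE : ∀ n ∈ N, q n ∈ E * E → q n = 1)
    (hSA : (S ∩ A).Nonempty) {s : G} (hs : s ∈ S) (hsA : s ∈ A * (N : Set G)) : s ∈ A := by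
  obtain ⟨z, hzS, hzA⟩ := hSA
  obtain ⟨a, ha, n, hn, rfl⟩ := hsA
  have hqn : q n = q (a⁻¹ * z) * q (z⁻¹ * (a * n)) := by
    rw [← map_mul, mul_assoc, mul_inv_cancel_left, inv_mul_cancel_left]
  have hker : q n = 1 := hE n hn (hqn ▸ mul_mem_mul (hA.small a ha z hzA) (hS.small z hzS _ hs))
  exact hA.mul_mem a ha n ⟨hn, hker⟩

namespace IsBinarySubbaseMod

theorem isBinaryFamily_union_isSmallPiece (h : IsBinarySubbaseMod N ℬ)
    (hE : ∀ n ∈ N, q n ∈ E * E → q n = 1) :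
    IsBinaryFamily (ℬ ∪ {S | IsSmallPiece N ℬ q E S}) := by
  intro 𝒜 h𝒜 hlinked
  obtain ⟨x, hx⟩ := h.binary.exists_forall_subset_imp_mem hlinked
  by_cases hpiece : ∃ S ∈ 𝒜, IsSmallPiece N ℬ q E S
  · obtain ⟨S, hS𝒜, hS⟩ := hpiece
    have hsub (A : Set G) : A ⊆ A * (N : Set G) := subset_mul_left A N.one_mem
    obtain ⟨s, hs, n, hn, rfl⟩ : x ∈ S * (N : Set G) := hx S hS𝒜 _ hS.mul_subgroup_mem (hsub S)
    have hmem : ∀ A ∈ 𝒜, ∀ B ∈ ℬ, A ⊆ B → s ∈ B := fun A hA B hB hAB =>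
      (h.mul_mem_iff hB hn).1 (hx A hA B hB hAB)
    refine ⟨s, fun A hA => ?_⟩
    rcases h𝒜 hA with hAℬ | hApiece
    · exact hmem A hA A hAℬ Subset.rfl
    · exact hS.mem_of_mem_mul_subgroup hApiece hE (hlinked S hS𝒜 A hA) hs
        (hmem A hA _ hApiece.mul_subgroup_mem (hsub A))
  · exact ⟨x, fun A hA => hx A hA A ((h𝒜 hA).resolve_right fun hA' => hpiece ⟨A, hA, hA'⟩)
      Subset.rfl⟩

theorem isSmallPiece_inter_preimage [TopologicalSpace Q] (h : IsBinarySubbaseMod N ℬ)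
    (hq : Continuous q) {B : Set G} (hB : B ∈ ℬ) {W : Set Q} (hW : IsClosed W)
    (hWE : ∀ v ∈ W, ∀ w ∈ W, v⁻¹ * w ∈ E) (hBW : B ⊆ q ⁻¹' W * (N : Set G)) :
    IsSmallPiece N ℬ q E (B ∩ q ⁻¹' W) where
  isClosed := (h.isClosed B hB).inter (hW.preimage hq)
  mul_mem := by
    rintro z ⟨hzB, hzW⟩ n ⟨hn, hnq⟩
    refine ⟨h.mul_mem B hB z hzB n hn, ?_⟩
    rwa [mem_preimage, map_mul, MonoidHom.mem_ker.1 hnq, mul_one]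
  mul_subgroup_mem := by
    suffices B ∩ q ⁻¹' W * (N : Set G) = B from this.symm ▸ hB
    refine Subset.antisymm ?_ fun b hb => ?_
    · rintro _ ⟨z, hz, n, hn, rfl⟩
      exact h.mul_mem B hB z hz.1 n hn
    · obtain ⟨z, hz, n, hn, rfl⟩ := hBW hb
      exact ⟨z, ⟨(h.mul_mem_iff hB hn).1 hb, hz⟩, n, hn, rfl⟩
  small := by
    rintro z ⟨-, hz⟩ w ⟨-, hw⟩
    rw [map_mul, map_inv]
    exact hWE _ hz _ hw

end IsBinarySubbaseMod

variable [TopologicalSpace Q] [IsTopologicalGroup Q]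

theorem exists_isClosed_mem_nhds_inv_mul_mem (hE : E ∈ 𝓝 (1 : Q)) (y : Q) :
    ∃ W ∈ 𝓝 y, IsClosed W ∧ ∀ v ∈ W, ∀ w ∈ W, v⁻¹ * w ∈ E := by
  have hcont : ContinuousAt (fun p : Q × Q => p.1⁻¹ * p.2) (y, y) := by fun_prop
  have hmem : {p : Q × Q | p.1⁻¹ * p.2 ∈ E} ∈ 𝓝 (y, y) :=
    hcont.preimage_mem_nhds (by rwa [inv_mul_cancel])
  rw [nhds_prod_eq, mem_prod_same_iff] at hmem
  obtain ⟨U, hU, hUE⟩ := hmem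
  obtain ⟨W, hW, hWclosed, hWU⟩ := exists_mem_nhds_isClosed_subset hU
  exact ⟨W, hW, hWclosed, fun v hv w hw => hUE (mk_mem_prod (hWU hv) (hWU hw))⟩

namespace IsBinarySubbaseMod

variable [IsTopologicalGroup G] [CompactSpace G]

theorem separating_isSmallPiece (h : IsBinarySubbaseMod N ℬ) (hinter : FiniteInter ℬ)
    (hq : Continuous q) (hEnhds : E ∈ 𝓝 1) (hE : ∀ n ∈ N, q n ∈ E * E → q n = 1) {x y : G}
    (hN : x⁻¹ * y ∈ N) (hker : x⁻¹ * y ∉ q.ker) :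
    ∃ ℱ ⊆ {S | IsSmallPiece N ℬ q E S}, ℱ.Finite ∧ ⋃₀ ℱ ∈ 𝓝 y ∧ x ∉ ⋃₀ ℱ := by
  obtain ⟨W, hW, hWclosed, hWE⟩ := exists_isClosed_mem_nhds_inv_mul_mem hEnhds (q y)
  have hWy : q ⁻¹' W ∈ 𝓝 y := hq.continuousAt.preimage_mem_nhds hW
  obtain ⟨ℱ, hℱ, hfin, hnhds, hsub⟩ := h.exists_sUnion_mem_nhds_subset hinter
    (V := interior (q ⁻¹' W) * (N : Set G)) isOpen_interior.mul_right (y := y)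
    fun n hn => mul_mem_mul (mem_interior_iff_mem_nhds.2 hWy) hn
  refine ⟨(· ∩ q ⁻¹' W) '' ℱ, ?_, hfin.image _, ?_, ?_⟩
  · rintro _ ⟨B, hB, rfl⟩
    exact h.isSmallPiece_inter_preimage hq (hℱ hB) hWclosed hWE <|
      (subset_sUnion_of_mem hB).trans <| hsub.trans <| mul_subset_mul_right interior_subset
  · rw [sUnion_image, ← iUnion₂_inter, ← sUnion_eq_biUnion]
    exact inter_mem hnhds hWy
  · rintro ⟨_, ⟨B, -, rfl⟩, -, hxW⟩
    have hxy : q (x⁻¹ * y) ∈ E := by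
      rw [map_mul, map_inv]
      exact hWE _ hxW _ (mem_of_mem_nhds hW)
    exact hker (hE _ hN (subset_mul_left E (mem_of_mem_nhds hEnhds) hxy))

theorem union_isSmallPiece (h : IsBinarySubbaseMod N ℬ) (hinter : FiniteInter ℬ)
    (hq : Continuous q) (hEnhds : E ∈ 𝓝 1) (hE : ∀ n ∈ N, q n ∈ E * E → q n = 1) :
    IsBinarySubbaseMod (N ⊓ q.ker) (ℬ ∪ {S | IsSmallPiece N ℬ q E S}) where
  isClosed := by
    rintro B (hB | hB)
    exacts [h.isClosed B hB, hB.isClosed]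
  mul_mem := by
    rintro B (hB | hB) x hx n hn
    exacts [h.mul_mem B hB x hx n hn.1, hB.mul_mem x hx n hn]
  binary := h.isBinaryFamily_union_isSmallPiece hE
  invariant := by
    rintro g B (hB | hB)
    exacts [.inl (h.invariant g B hB), .inr (hB.smul h.invariant g)]
  separating x y hxy := by
    by_cases hN : x⁻¹ * y ∈ N
    · obtain ⟨ℱ, hℱ, hsep⟩ := h.separating_isSmallPiece hinter hq hEnhds hE hN
        fun hker => hxy ⟨hN, hker⟩
      exact ⟨ℱ, hℱ.trans subset_union_right, hsep⟩
    · obtain ⟨ℱ, hℱ, hsep⟩ := h.separating x y hN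
      exact ⟨ℱ, hℱ.trans subset_union_left, hsep⟩

theorem exists_superset_of_discreteTopology_map (h : IsBinarySubbaseMod N ℬ) (hq : Continuous q)
    [DiscreteTopology (N.map q)] : ∃ ℬ', ℬ ⊆ ℬ' ∧ IsBinarySubbaseMod (N ⊓ q.ker) ℬ' := by
  obtain ⟨D, hD, hDN⟩ := nhds_inter_eq_singleton_of_mem_discrete
    (s := (N.map q : Set Q)) ⟨inferInstance⟩ (N.map q).one_mem
  obtain ⟨E, hEopen, h1E, hED⟩ := exists_open_nhds_one_mul_subset hD
  have hE : ∀ n ∈ N, q n ∈ E * E → q n = 1 := fun n hn hqn =>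
    hDN.subset ⟨hED hqn, mem_image_of_mem q hn⟩
  exact ⟨_, Subset.trans (fun B hB => .basic hB) subset_union_left,
    h.finiteInterClosure.union_isSmallPiece (FiniteInter.finiteInterClosure_finiteInter ℬ) hq
      (hEopen.mem_nhds h1E) hE⟩

end IsBinarySubbaseMod

end Refinement

theorem IsBinarySubbaseMod.union_preimage {G Q : Type*} [Group G] [TopologicalSpace G] [Group Q]
    [TopologicalSpace Q] {N : Subgroup G} {ℬ : Set (Set G)} (h : IsBinarySubbaseMod N ℬ)
    {q : G →* Q} (hq : Continuous q) (hsurj : N.map q = ⊤) {𝒞 : Set (Set Q)}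
    (h𝒞 : IsBinarySubbaseMod ⊥ 𝒞) :
    IsBinarySubbaseMod (N ⊓ q.ker) (ℬ ∪ (q ⁻¹' ·) '' 𝒞) where
  isClosed := by
    rintro B (hB | ⟨C, hC, rfl⟩)
    exacts [h.isClosed B hB, (h𝒞.isClosed C hC).preimage hq]
  mul_mem := by
    rintro B (hB | ⟨C, -, rfl⟩) x hx n ⟨hn, hnq⟩
    · exact h.mul_mem B hB x hx n hn
    · rwa [mem_preimage, map_mul, MonoidHom.mem_ker.1 hnq, mul_one]
  binary := by
    intro 𝒜 h𝒜 hlinked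
    obtain ⟨x, hx⟩ := h.binary (𝒜 ∩ ℬ) inter_subset_right
      fun A hA B hB => hlinked A hA.1 B hB.1
    obtain ⟨t, ht⟩ := h𝒞.binary {C ∈ 𝒞 | q ⁻¹' C ∈ 𝒜} (sep_subset _ _) fun A hA B hB =>
      nonempty_of_nonempty_preimage (hlinked _ hA.2 _ hB.2)
    obtain ⟨n, hn, hqn⟩ : (q x)⁻¹ * t ∈ N.map q := hsurj ▸ Subgroup.mem_top _
    refine ⟨x * n, fun A hA => ?_⟩
    rcases h𝒜 hA with hAℬ | ⟨C, hC, rfl⟩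
    · exact h.mul_mem A hAℬ x (hx A ⟨hA, hAℬ⟩) n hn
    · rw [mem_preimage, map_mul, hqn, mul_inv_cancel_left]
      exact ht C ⟨hC, hA⟩
  invariant := by
    rintro g B (hB | ⟨C, hC, rfl⟩)
    · exact .inl (h.invariant g B hB)
    · refine .inr ⟨q g • C, h𝒞.invariant _ C hC, ?_⟩
      ext x
      simp only [mem_preimage, mem_smul_set_iff_inv_smul_mem, smul_eq_mul, map_mul, map_inv]
  separating x y hxy := by
    by_cases hN : x⁻¹ * y ∈ N
    · have hker : x⁻¹ * y ∉ q.ker := fun hker => hxy ⟨hN, hker⟩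
      have hqxy : (q x)⁻¹ * q y ∉ (⊥ : Subgroup Q) := by
        rwa [← map_inv, ← map_mul, Subgroup.mem_bot, ← MonoidHom.mem_ker]
      obtain ⟨ℱ, hℱ, hfin, hnhds, hxℱ⟩ := h𝒞.separating _ _ hqxy
      have heq : ⋃₀ ((q ⁻¹' ·) '' ℱ) = q ⁻¹' ⋃₀ ℱ := by rw [sUnion_image, preimage_sUnion]
      exact ⟨(q ⁻¹' ·) '' ℱ, (image_mono hℱ).trans subset_union_right, hfin.image _,
        heq ▸ hq.continuousAt.preimage_mem_nhds hnhds, heq ▸ hxℱ⟩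
    · obtain ⟨ℱ, hℱ, hsep⟩ := h.separating x y hN
      exact ⟨ℱ, hℱ.trans subset_union_left, hsep⟩

theorem image_circleExp_Icc_add_int_mul_two_pi (a b : ℝ) (m : ℤ) :
    Circle.exp '' Icc (a + m * (2 * Real.pi)) (b + m * (2 * Real.pi)) = Circle.exp '' Icc a b := by
  rw [← image_add_const_Icc, image_image]
  exact image_congr fun x _ => Circle.exp_eq_exp.2 ⟨m, rfl⟩

/-- The family of arcs of the circle of length at most one. A single arc is less than a third of
the circle, so that three of them never wrap around it. -/
def shortArcs : Set (Set Circle) :=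
  {I | ∃ a b : ℝ, b - a ≤ 1 ∧ I = Circle.exp '' Icc a b}

theorem exists_lift_Icc_of_mem_shortArcs {I : Set Circle} (hI : I ∈ shortArcs) {a₀ b₀ : ℝ}
    (hmeet : (I ∩ Circle.exp '' Icc a₀ b₀).Nonempty) :
    ∃ a b : ℝ, I = Circle.exp '' Icc a b ∧ Icc a b ⊆ Icc (a₀ - 1) (b₀ + 1) := by
  obtain ⟨a, b, hab, rfl⟩ := hI
  obtain ⟨_, ⟨s, hs, rfl⟩, t, ht, hst⟩ := hmeet
  obtain ⟨m, hm⟩ := Circle.exp_eq_exp.1 hst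
  exact ⟨_, _, (image_circleExp_Icc_add_int_mul_two_pi a b m).symm,
    Icc_subset_Icc (by linarith [hs.2, ht.1]) (by linarith [hs.1, ht.2])⟩

theorem exists_forall_mem_Icc_of_pairwise {ι : Type*} {s : Set ι} {a b : ι → ℝ}
    (h : ∀ i ∈ s, ∀ j ∈ s, a i ≤ b j) : ∃ t, ∀ i ∈ s, t ∈ Icc (a i) (b i) := by
  rcases s.eq_empty_or_nonempty with rfl | hs
  · exact ⟨0, fun i hi => hi.elim⟩
  · obtain ⟨t, hat, htb⟩ := exists_between_of_forall_le (hs.image a) (hs.image b) <|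
      forall_mem_image.2 fun i hi => forall_mem_image.2 fun j hj => h i hi j hj
    exact ⟨t, fun i hi => ⟨hat (mem_image_of_mem a hi), htb (mem_image_of_mem b hi)⟩⟩

theorem isBinaryFamily_shortArcs : IsBinaryFamily shortArcs := by
  intro 𝒜 h𝒜 hlinked
  rcases 𝒜.eq_empty_or_nonempty with rfl | ⟨I₀, hI₀⟩
  · exact ⟨1, fun A hA => hA.elim⟩
  obtain ⟨a₀, b₀, hab₀, rfl⟩ := h𝒜 hI₀
  have hlift : ∀ I ∈ 𝒜, ∃ a b : ℝ, I = Circle.exp '' Icc a b ∧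
      Icc a b ⊆ Icc (a₀ - 1) (b₀ + 1) := fun I hI =>
    exists_lift_Icc_of_mem_shortArcs (h𝒜 hI) (hlinked I hI _ hI₀)
  choose! a b hI hsub using hlift
  have hinj : InjOn Circle.exp (Icc (a₀ - 1) (b₀ + 1)) :=
    Circle.exp_injOn_Icc (by linarith [Real.pi_gt_three])
  have hpairwise : ∀ I ∈ 𝒜, ∀ J ∈ 𝒜, a I ≤ b J := by
    intro I hI𝒜 J hJ𝒜
    have hne := hlinked I hI𝒜 J hJ𝒜
    rw [hI I hI𝒜, hI J hJ𝒜, ← hinj.image_inter (hsub I hI𝒜) (hsub J hJ𝒜), image_nonempty] at hne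
    obtain ⟨t, htI, htJ⟩ := hne
    exact htI.1.trans htJ.2
  obtain ⟨t, ht⟩ := exists_forall_mem_Icc_of_pairwise hpairwise
  exact ⟨Circle.exp t, fun I hI𝒜 => hI I hI𝒜 ▸ mem_image_of_mem _ (ht I hI𝒜)⟩

theorem isBinarySubbaseMod_shortArcs : IsBinarySubbaseMod ⊥ shortArcs where
  isClosed := by
    rintro _ ⟨a, b, -, rfl⟩
    exact (isCompact_Icc.image Circle.exp.continuous).isClosed
  mul_mem := by
    rintro B - x hx n hn
    rwa [Subgroup.mem_bot.1 hn, mul_one]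
  binary := isBinaryFamily_shortArcs
  invariant := by
    rintro g _ ⟨a, b, hab, rfl⟩
    obtain ⟨t, rfl⟩ := Circle.exp_surjective g
    refine ⟨t + a, t + b, by linarith, ?_⟩
    rw [← image_const_add_Icc, image_image, ← image_smul, image_image]
    exact image_congr fun x _ => (Circle.exp_add t x).symm
  separating x y hxy := by
    obtain ⟨t, rfl⟩ := Circle.exp_surjective y
    have hne : Circle.exp t ≠ x := fun h => hxy (by rw [h, inv_mul_cancel]; exact one_mem _)
    have hnhds : Circle.exp ⁻¹' {x}ᶜ ∈ 𝓝 t :=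
      Circle.exp.continuous.continuousAt.preimage_mem_nhds (isOpen_ne.mem_nhds hne)
    obtain ⟨ε, hε, hsub⟩ := Metric.nhds_basis_closedBall.mem_iff.1 hnhds
    have hδ : 0 < min ε (1 / 2) := lt_min hε (by norm_num)
    refine ⟨{Circle.exp '' Metric.closedBall t (min ε (1 / 2))}, ?_, finite_singleton _, ?_, ?_⟩
    · rintro _ rfl
      rw [Real.closedBall_eq_Icc]
      exact ⟨_, _, by linarith [min_le_right ε (1 / 2)], rfl⟩
    · rw [sUnion_singleton]
      exact isLocalHomeomorph_circleExp.isOpenMap.image_mem_nhds (Metric.closedBall_mem_nhds t hδ)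
    · rw [sUnion_singleton]
      rintro ⟨v, hv, hvx⟩
      exact hsub (Metric.closedBall_subset_closedBall (min_le_left _ _) hv) hvx

theorem discreteTopology_or_eq_top_of_isClosed_circle {H : Subgroup Circle}
    (hH : IsClosed (H : Set Circle)) : DiscreteTopology H ∨ H = ⊤ := by
  let S : AddSubgroup ℝ := (Subgroup.toAddSubgroup H).comap Circle.expHom
  by_cases hdense : ∀ ε > 0, ∃ g ∈ S, g ∈ Ioo 0 ε
  · have hSclosed : IsClosed (S : Set ℝ) := hH.preimage Circle.exp.continuous
    refine .inr (eq_top_iff.2 fun z _ => ?_)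
    obtain ⟨t, rfl⟩ := Circle.exp_surjective z
    have ht : t ∈ closure (S : Set ℝ) := S.dense_of_not_isolated_zero hdense t
    rwa [hSclosed.closure_eq] at ht
  · push Not at hdense
    obtain ⟨ε, hε, hgap⟩ := hdense
    have hopen : IsOpen (Circle.exp '' Ioo (-ε) ε) :=
      isLocalHomeomorph_circleExp.isOpenMap _ isOpen_Ioo
    refine .inl (discreteTopology_of_isOpen_singleton_one ?_)
    convert hopen.preimage continuous_subtype_val using 1
    refine Subset.antisymm (singleton_subset_iff.2 ⟨0, ⟨by linarith, hε⟩, Circle.exp_zero⟩) ?_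
    rintro ⟨_, hz⟩ ⟨t, ⟨hεt, htε⟩, rfl⟩
    have htS : t ∈ S := hz
    have ht0 : t = 0 := by
      rcases lt_trichotomy t 0 with ht | ht | ht
      · exact (hgap (-t) (S.neg_mem htS) ⟨by linarith, by linarith⟩).elim
      · exact ht
      · exact (hgap t htS ⟨ht, htε⟩).elim
    simp only [ht0, Circle.exp_zero, mem_singleton_iff, Subgroup.mk_eq_one]

theorem IsBinarySubbaseMod.exists_superset_of_circle {G : Type*} [Group G] [TopologicalSpace G]
    [IsTopologicalGroup G] [CompactSpace G] {N : Subgroup G} {ℬ : Set (Set G)}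
    (h : IsBinarySubbaseMod N ℬ) (χ : G →ₜ* Circle) :
    ∃ ℬ', ℬ ⊆ ℬ' ∧ IsBinarySubbaseMod (N ⊓ (χ : G →* Circle).ker) ℬ' := by
  have hclosed : IsClosed (N.map (χ : G →* Circle) : Set Circle) :=
    (h.isClosed_subgroup.isCompact.image χ.continuous_toFun).isClosed
  rcases discreteTopology_or_eq_top_of_isClosed_circle hclosed with hdisc | htop
  · exact h.exists_superset_of_discreteTopology_map χ.continuous_toFun
  · exact ⟨_, subset_union_left,
      h.union_preimage χ.continuous_toFun htop isBinarySubbaseMod_shortArcs⟩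

open MeasureTheory InnerProductSpace ContinuousLinearMap

theorem exists_isClosed_starSubalgebra_mul_comm {A : Type*} [CStarAlgebra A] {S : Set A}
    (hcomm : ∀ x ∈ S, ∀ y ∈ S, x * y = y * x)
    (hcomm_star : ∀ x ∈ S, ∀ y ∈ S, x * star y = star y * x) :
    ∃ B : StarSubalgebra ℂ A, S ⊆ B ∧ IsClosed (B : Set A) ∧ ∀ x y : B, x * y = y * x := by
  have := StarAlgebra.isMulCommutative_adjoin ℂ hcomm hcomm_star
  let _ := StarSubalgebra.commRingTopologicalClosure (StarAlgebra.adjoin ℂ S) mul_comm'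
  exact ⟨(StarAlgebra.adjoin ℂ S).topologicalClosure,
    (StarAlgebra.subset_adjoin ℂ S).trans (StarSubalgebra.le_topologicalClosure _),
    StarSubalgebra.isClosed_topologicalClosure _, mul_comm⟩

section CommutativeOperators

variable {G : Type*} [TopologicalSpace G]

theorem exists_character_of_mul_ne [Monoid G] {B : Type*} [CommCStarAlgebra B] (π : G →* B)
    (hπ : ∀ g, π g ∈ unitary B) {T : B} (hcont : Continuous fun g => π g * T) {a : G}
    (ha : π a * T ≠ T) : ∃ χ : G →ₜ* Circle, χ a ≠ 1 := by
  obtain ⟨φ, hφ⟩ : ∃ φ : WeakDual.characterSpace ℂ B, φ (π a * T) ≠ φ T :=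
    DFunLike.ne_iff.1 ((gelfandStarTransform B).injective.ne ha)
  have hφT : φ T ≠ 0 := fun h => hφ (by rw [map_mul, h, mul_zero])
  have hnorm (g : G) : φ (π g) ∈ Submonoid.unitSphere ℂ :=
    mem_sphere_zero_iff_norm.2 (CStarRing.norm_of_mem_unitary (Unitary.map_mem φ (hπ g)))
  have hφcont : Continuous fun g => φ (π g) := by
    have heq : (fun g => φ (π g)) = fun g => φ (π g * T) / φ T :=
      funext fun g => by rw [map_mul, mul_div_cancel_right₀ _ hφT]
    rw [heq]
    exact ((map_continuous φ).comp hcont).div_const _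
  let χ : G →* Circle := ((φ : B →* ℂ).comp π).codRestrict (Submonoid.unitSphere ℂ) hnorm
  refine ⟨⟨χ, continuous_induced_rng.2 hφcont⟩, fun h => hφ ?_⟩
  have hφa : φ (π a) = 1 := congrArg Subtype.val h
  rw [map_mul, hφa, one_mul]

theorem exists_character_of_commute [CommMonoid G] {A : Type*} [CStarAlgebra A] (π : G →* A)
    (hπ : ∀ g, π g ∈ unitary A) {T : A} (hT : IsSelfAdjoint T) (hcomm : ∀ g, Commute (π g) T)
    (hcont : Continuous fun g => π g * T) {a : G} (ha : π a * T ≠ T) :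
    ∃ χ : G →ₜ* Circle, χ a ≠ 1 := by
  have hππ (g h : G) : Commute (π g) (π h) := (Commute.all g h).map π
  have hπstar (g h : G) : Commute (π g) (star (π h)) :=
    (((Commute.all g h).map (π.codRestrict (unitary A) hπ)).inv_right).map (unitary A).subtype
  obtain ⟨B, hB, hclosed, hBcomm⟩ :=
    exists_isClosed_starSubalgebra_mul_comm (S := insert T (range π)) (by
      rintro _ (rfl | ⟨g, rfl⟩) _ (rfl | ⟨h, rfl⟩)
      exacts [rfl, (hcomm h).symm, hcomm g, hππ g h]) (by
      rintro _ (rfl | ⟨g, rfl⟩) _ (rfl | ⟨h, rfl⟩)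
      exacts [hT.star_eq.symm ▸ rfl, hT.star_eq ▸ (hcomm h).star_star.symm,
        hT.star_eq.symm ▸ hcomm g, hπstar g h])
  let _ : CommCStarAlgebra B := { StarSubalgebra.cstarAlgebra B with mul_comm := hBcomm }
  exact exists_character_of_mul_ne (π.codRestrict B fun g => hB (mem_insert_of_mem T ⟨g, rfl⟩))
    (fun g => ⟨Subtype.ext (hπ g).1, Subtype.ext (hπ g).2⟩) (T := ⟨T, hB (mem_insert T _)⟩)
    (continuous_induced_rng.2 hcont) fun h => ha (congrArg Subtype.val h)

end CommutativeOperators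

section UnitaryRepresentation

variable {G H : Type*} [NormedAddCommGroup H] [InnerProductSpace ℂ H]

theorem continuous_rankOne : Continuous fun p : H × H => rankOne ℂ p.1 p.2 :=
  (smulRightL ℂ H H).continuous₂.comp₂ ((innerSL ℂ).continuous.comp continuous_snd)
    continuous_fst

theorem comp_rankOne_eq_rankOne_comp (e : H ≃ₗᵢ[ℂ] H) (u v : H) :
    (e : H →L[ℂ] H) ∘L rankOne ℂ u v = rankOne ℂ (e u) (e v) ∘L (e : H →L[ℂ] H) := by
  ext f
  simp

variable [MeasurableSpace G] [Group G]

/-- The average over `G`, with respect to the measure `μ`, of the rank-one operators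
`f ↦ ⟪U x φ, f⟫ • U x φ` attached to the orbit of `φ` under a unitary representation `U`. -/
noncomputable def averageRankOne (U : G →* H ≃ₗᵢ[ℂ] H) (μ : Measure G) (φ : H) : H →L[ℂ] H :=
  ∫ x, rankOne ℂ (U x φ) (U x φ) ∂μ

variable {U : G →* H ≃ₗᵢ[ℂ] H} {μ : Measure G} {φ : H}

theorem isSelfAdjoint_averageRankOne [CompleteSpace H] :
    IsSelfAdjoint (averageRankOne U μ φ) := by
  have h : star (averageRankOne U μ φ) = ∫ x, star (rankOne ℂ (U x φ) (U x φ)) ∂μ :=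
    ((starL' ℝ : (H →L[ℂ] H) ≃L[ℝ] (H →L[ℂ] H)).integral_comp_comm _).symm
  simp only [star_eq_adjoint, adjoint_rankOne] at h
  exact h

variable [TopologicalSpace G] [BorelSpace G] [CompactSpace G] [IsFiniteMeasureOnCompacts μ]

theorem integrable_rankOne_orbit (hU : Continuous fun g => U g φ) :
    Integrable (fun x => rankOne ℂ (U x φ) (U x φ)) μ :=
  (continuous_rankOne.comp (hU.prodMk hU)).integrable_of_hasCompactSupport (.of_compactSpace _)

theorem coe_mul_averageRankOne (hU : Continuous fun g => U g φ) (g : G) :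
    (U g : H →L[ℂ] H) * averageRankOne U μ φ = ∫ x, rankOne ℂ (U (g * x) φ) (U x φ) ∂μ := by
  rw [averageRankOne, ← integral_const_mul_of_integrable (integrable_rankOne_orbit hU)]
  simp [mul_def, comp_rankOne]

theorem continuous_coe_mul_averageRankOne [ContinuousMul G] (hU : Continuous fun g => U g φ) :
    Continuous fun g => (U g : H →L[ℂ] H) * averageRankOne U μ φ := by
  simp only [coe_mul_averageRankOne hU, ← continuousOn_univ]
  refine continuousOn_integral_of_compact_support isCompact_univ ?_ fun _ _ _ h =>
    absurd (mem_univ _) h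
  exact (continuous_rankOne.comp ((hU.comp continuous_mul).prodMk
    (hU.comp continuous_snd))).continuousOn

theorem commute_coe_averageRankOne [ContinuousMul G] [μ.IsMulLeftInvariant]
    (hU : Continuous fun g => U g φ) (g : G) :
    Commute (U g : H →L[ℂ] H) (averageRankOne U μ φ) := by
  have hint := integrable_rankOne_orbit (μ := μ) hU
  calc (U g : H →L[ℂ] H) * averageRankOne U μ φ
      = ∫ x, (U g : H →L[ℂ] H) * rankOne ℂ (U x φ) (U x φ) ∂μ :=
        (integral_const_mul_of_integrable hint).symm
    _ = ∫ x, rankOne ℂ (U (g * x) φ) (U (g * x) φ) * (U g : H →L[ℂ] H) ∂μ := by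
        simp only [mul_def, comp_rankOne_eq_rankOne_comp, map_mul, LinearIsometryEquiv.coe_mul,
          Function.comp_apply]
    _ = ∫ x, rankOne ℂ (U x φ) (U x φ) * (U g : H →L[ℂ] H) ∂μ :=
        integral_mul_left_eq_self (fun x => rankOne ℂ (U x φ) (U x φ) * (U g : H →L[ℂ] H)) g
    _ = averageRankOne U μ φ * (U g : H →L[ℂ] H) := integral_mul_const_of_integrable hint

theorem inner_averageRankOne_self [CompleteSpace H] (hU : Continuous fun g => U g φ) (f : H) :
    inner ℂ f (averageRankOne U μ φ f) = ∫ x, ‖inner ℂ (U x φ) f‖ ^ 2 ∂μ := by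
  have hint := integrable_rankOne_orbit (μ := μ) hU
  rw [averageRankOne, integral_apply hint, ← integral_inner (hint.apply_continuousLinearMap f),
    ← integral_complex_ofReal]
  refine integral_congr_ae (.of_forall fun x => ?_)
  simp only [rankOne_apply, inner_smul_right]
  rw [← inner_conj_symm f, Complex.mul_conj', Complex.ofReal_pow]

theorem inner_eq_zero_of_averageRankOne_eq_zero [CompleteSpace H] [μ.IsOpenPosMeasure]
    (hU : Continuous fun g => U g φ) {f : H} (hf : averageRankOne U μ φ f = 0) (x : G) :
    inner ℂ (U x φ) f = 0 := by
  have hcont : Continuous fun x => ‖inner ℂ (U x φ) f‖ ^ 2 := by fun_prop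
  have hint : ∫ x, ‖inner ℂ (U x φ) f‖ ^ 2 ∂μ = 0 := by
    rw [← Complex.ofReal_eq_zero, ← inner_averageRankOne_self hU, hf, inner_zero_right]
  by_contra hx
  exact (hcont.integral_pos_of_hasCompactSupport_nonneg_nonzero (μ := μ) (.of_compactSpace _)
    (fun _ => sq_nonneg _) (pow_ne_zero 2 (norm_ne_zero_iff.2 hx))).ne' hint

theorem coe_mul_averageRankOne_ne [CompleteSpace H] [ContinuousMul G] [μ.IsMulLeftInvariant]
    [μ.IsOpenPosMeasure] (hU : Continuous fun g => U g φ) {a : G} (ha : U a φ ≠ φ) :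
    (U a : H →L[ℂ] H) * averageRankOne U μ φ ≠ averageRankOne U μ φ := by
  intro h
  have hker : averageRankOne U μ φ (U a φ - φ) = 0 := by
    rw [map_sub, sub_eq_zero]
    exact DFunLike.congr_fun ((commute_coe_averageRankOne hU a).eq.symm.trans h) φ
  have horth (x : G) : inner ℂ (U x φ) (U a φ - φ) = 0 :=
    inner_eq_zero_of_averageRankOne_eq_zero hU hker x
  refine ha (sub_eq_zero.1 (inner_self_eq_zero (𝕜 := ℂ).1 ?_))
  have h1 : inner ℂ φ (U a φ - φ) = 0 := by simpa using horth 1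
  rw [inner_sub_left, horth a, h1, sub_zero]

end UnitaryRepresentation

theorem exists_character_of_unitary_representation {G H : Type*} [CommGroup G]
    [TopologicalSpace G] [IsTopologicalGroup G] [CompactSpace G] [NormedAddCommGroup H]
    [InnerProductSpace ℂ H] [CompleteSpace H] (U : G →* H ≃ₗᵢ[ℂ] H) {φ : H}
    (hU : Continuous fun g => U g φ) {a : G} (ha : U a φ ≠ φ) : ∃ χ : G →ₜ* Circle, χ a ≠ 1 := by
  borelize G
  let V : G →* unitary (H →L[ℂ] H) := Unitary.linearIsometryEquiv.symm.toMonoidHom.comp U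
  exact exists_character_of_commute ((unitary (H →L[ℂ] H)).subtype.comp V) (fun g => (V g).2)
    (isSelfAdjoint_averageRankOne (μ := Measure.haar)) (commute_coe_averageRankOne hU)
    (continuous_coe_mul_averageRankOne hU) (coe_mul_averageRankOne_ne hU ha)

section RegularRepresentation

variable {G : Type*} [Group G] [MeasurableSpace G]

/-- The left regular representation of `G` on `L²(G)`, acting by `(g • f) x = f (g⁻¹ * x)`. -/
noncomputable def regularRepresentation [MeasurableMul G] (μ : Measure G) [μ.IsMulLeftInvariant] :
    G →* Lp ℂ 2 μ ≃ₗᵢ[ℂ] Lp ℂ 2 μ where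
  toFun g :=
    { DistribMulAction.toLinearEquiv ℂ (Lp ℂ 2 μ) (DomMulAct.mk g⁻¹) with
      norm_map' := DomMulAct.norm_smul_Lp _ }
  map_one' := LinearIsometryEquiv.ext fun f =>
    show DomMulAct.mk (1⁻¹ : G) • f = f by rw [inv_one, DomMulAct.mk_one, one_smul]
  map_mul' g h := LinearIsometryEquiv.ext fun f =>
    show DomMulAct.mk (g * h)⁻¹ • f = DomMulAct.mk g⁻¹ • DomMulAct.mk h⁻¹ • f by
      rw [mul_inv_rev, DomMulAct.mk_mul, mul_smul]

variable [TopologicalSpace G] [BorelSpace G] [IsTopologicalGroup G] (μ : Measure G)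
  [μ.IsMulLeftInvariant]

theorem continuous_regularRepresentation [IsLocallyFiniteMeasure μ] [μ.InnerRegularCompactLTTop]
    (f : Lp ℂ 2 μ) : Continuous fun g => regularRepresentation μ g f := by
  have : Fact ((2 : ENNReal) ≠ ⊤) := ⟨ENNReal.ofNat_ne_top⟩
  have hmk : Continuous fun g : G => DomMulAct.mk g⁻¹ :=
    DomMulAct.continuous_mk.comp continuous_inv
  exact hmk.smul continuous_const

theorem exists_regularRepresentation_ne [CompactSpace G] [T2Space G] [IsFiniteMeasure μ]
    [μ.IsOpenPosMeasure] {a : G} (ha : a ≠ 1) : ∃ f, regularRepresentation μ a f ≠ f := by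
  obtain ⟨f, hf1, hfa, -⟩ := exists_continuous_zero_one_of_isClosed
    (isClosed_singleton (x := (1 : G))) isClosed_singleton (disjoint_singleton.2 ha.symm)
  let F : C(G, ℂ) := (⟨_, Complex.continuous_ofReal⟩ : C(ℝ, ℂ)).comp f
  refine ⟨ContinuousMap.toLp 2 μ ℂ F, fun h => ?_⟩
  have hF : F.comp ⟨fun x => a⁻¹ * x, continuous_const_mul a⁻¹⟩ = F :=
    ContinuousMap.toLp_injective (p := 2) (𝕜 := ℂ) μ h
  have hF1 : F (a⁻¹ * a) = F a := DFunLike.congr_fun hF a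
  simp [F, hf1 rfl, hfa rfl] at hF1

end RegularRepresentation

theorem exists_character_ne_one {G : Type*} [CommGroup G] [TopologicalSpace G]
    [IsTopologicalGroup G] [CompactSpace G] [T2Space G] {a : G} (ha : a ≠ 1) :
    ∃ χ : G →ₜ* Circle, χ a ≠ 1 := by
  borelize G
  obtain ⟨f, hf⟩ := exists_regularRepresentation_ne Measure.haar ha
  exact exists_character_of_unitary_representation _ (continuous_regularRepresentation _ f) hf

theorem IsZeroDimensional.exists_openNormalSubgroup_notMem {G : Type*} [Group G]
    [TopologicalSpace G] [IsTopologicalGroup G] [CompactSpace G] [T2Space G]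
    (h : IsZeroDimensional G) {a : G} (ha : a ≠ 1) : ∃ U : OpenNormalSubgroup G, a ∉ U := by
  obtain ⟨W, hW, h1W, hWa⟩ := h.exists_subset_of_mem_open (a := 1) (u := {a}ᶜ)
    (fun h1a => ha h1a.symm) isOpen_compl_singleton
  obtain ⟨U, hU⟩ := IsTopologicalGroup.exist_openNormalSubgroup_sub_clopen_nhds_of_one hW h1W
  exact ⟨U, fun haU => hWa (hU haU) rfl⟩

theorem IsBinarySubbaseMod.exists_superset_of_openNormalSubgroup {G : Type*} [Group G]
    [TopologicalSpace G] [IsTopologicalGroup G] [CompactSpace G] {N : Subgroup G}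
    {ℬ : Set (Set G)} (h : IsBinarySubbaseMod N ℬ) (U : OpenNormalSubgroup G) :
    ∃ ℬ', ℬ ⊆ ℬ' ∧ IsBinarySubbaseMod (N ⊓ U.toSubgroup) ℬ' := by
  have : DiscreteTopology (G ⧸ U.toSubgroup) := QuotientGroup.discreteTopology U.isOpen'
  have hq : Continuous (QuotientGroup.mk' U.toSubgroup) := continuous_quot_mk
  simpa only [QuotientGroup.ker_mk'] using h.exists_superset_of_discreteTopology_map hq

theorem mainTheorem6_general {G : Type*} [Group G] [TopologicalSpace G] [IsTopologicalGroup G]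
    [CompactSpace G]
    (hG : ∀ a : G, a ≠ 1 → (∃ U : OpenNormalSubgroup G, a ∉ U) ∨ ∃ χ : G →ₜ* Circle, χ a ≠ 1) :
    ∃ ℬ : Set (Set G), IsClosedSubbase ℬ ∧ IsBinaryFamily ℬ ∧ IsTranslationInvariant ℬ := by
  obtain ⟨ℬ, hℬ⟩ := IsBinarySubbaseMod.exists_bot (G := G) fun N ℬ h a _ ha => by
    rcases hG a ha with ⟨U, haU⟩ | ⟨χ, hχa⟩
    · exact ⟨N ⊓ U.toSubgroup, fun haN => haU haN.2, h.exists_superset_of_openNormalSubgroup U⟩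
    · exact ⟨N ⊓ (χ : G →* Circle).ker, fun haN => hχa haN.2, h.exists_superset_of_circle χ⟩
  exact ⟨ℬ, hℬ.isClosedSubbase, hℬ.binary, hℬ.invariant⟩

theorem mainTheorem6 :
    (∀ (G : Type*) [CommGroup G] [TopologicalSpace G] [IsTopologicalGroup G]
        [CompactSpace G] [T2Space G],
      ∃ ℬ : Set (Set G), IsClosedSubbase ℬ ∧ IsBinaryFamily ℬ ∧ IsTranslationInvariant ℬ) ∧
    (∀ (G : Type*) [Group G] [TopologicalSpace G] [IsTopologicalGroup G]
        [CompactSpace G] [T2Space G], IsZeroDimensional G →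
      ∃ ℬ : Set (Set G), IsClosedSubbase ℬ ∧ IsBinaryFamily ℬ ∧ IsTranslationInvariant ℬ) :=
  ⟨fun _ _ _ _ _ _ => mainTheorem6_general fun _ ha => .inr (exists_character_ne_one ha),
    fun _ _ _ _ _ _ hG => mainTheorem6_general fun _ ha =>
      .inl (hG.exists_openNormalSubgroup_notMem ha)⟩
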